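/- **Theorem (weighted Poincaré–Friedrichs inequality).** Let $d\ge 2$, and let $\Sigma\subset\mathbb R^d$ be a bounded hypersurface defined by a diffeomorphism $\alpha:\Sigma\to\widehat\Sigma\subset\mathbb R^{d-1}$, where $\widehat\Sigma$ is bounded and open with Lipschitz boundary, and where $\alpha$ is a $C^1$-diffeomorphism up to the boundary: $\alpha^{-1}$ extends to a $C^1$ map on a neighbourhood of $\overline{\widehat\Sigma}$ that is injective on $\overline{\widehat\Sigma}$ and has injective differential at each point of $\overline{\widehat\Sigma}$. Let $\gamma=\partial\Sigma=\alpha^{-1}(\partial\widehat\Sigma)$ and let $\mathrm{dist}$ denote the distance in $\mathbb R^d$ to $\gamma$. "Almost everywhere" and integrability on $\Sigma$ are understood with respect to Lebesgue measure on $\widehat\Sigma$ through $\alpha$. Let $b:\Sigma\to\mathbb R$ satisfy: - (A1) $b$ is a weight on $\Sigma$: there is $\widehat b\in L^1_{\mathrm{loc}}(\mathbb R^{d-1})$ with $\widehat b>0$ almost everywhere and $\widehat b|_{\widehat\Sigma}=b\circ\alpha^{-1}$. - (A2) There are a smooth cutoff function $\chi:\mathbb R^d\to[0,1]$ with $\chi=1$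 in a neighbourhood of $\gamma$, an integrable function $f$ on $\Sigma$ and a constant $c>0$ such that $b=c\,(\chi\,\mathrm{dist}^{1/2}+(1-\chi)f)$ almost everywhere on $\Sigma$. - (A3) $|b|\le b_{\max}$ almost everywhere on $\Sigma$ for some constant $b_{\max}>0$. - (A4) The function $f$ of (A2) satisfies $f\ge a$ almost everywhere on $\Sigma$ for some constant $a>0$. For a weight $\omega$ on $\Sigma$ and a scalar or vector valued $v$ on $\Sigma$ put $$\|v\|_{0,\omega,\Sigma}=\Big(\int_{\widehat\Sigma}|v\circ\alpha^{-1}|^2\,(\omega\circ\alpha^{-1})\,dx\Big)^{1/2}.$$ Let $\nabla_\tau$ be the tangential gradient on $\Sigma$, and let $C_0^\infty(\Sigma)$ be the set of functions $u$ on $\Sigma$ with compact support in $\Sigma$ for which $u\circ\alpha^{-1}$ is smooth on $\widehat\Sigma$. Then there is a constant $C>0$ such that for all $u\in C_0^\infty(\Sigma)$ the norm $\|\nabla_\tau u\|_{0,b,\Sigma}$ is finite and $$\|u\|_{0,b^{-1},\Sigma}\le C\,\|\nabla_\tau u\|_{0,b,\Sigma}.$$ -/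

import Mathlib

open MeasureTheory Set Topology
open scoped ENNReal NNReal ContDiff InnerProductSpace

noncomputable section

/-- `U ⊆ ℝⁿ` has a Lipschitz boundary: near every boundary point `p` there are a unit vector `ν`
and a Lipschitz function `g` on the hyperplane `ν^⊥` such that `U` is, near `p`, the set of points
lying strictly above the graph of `g` in the direction `ν`. -/
def HasLipschitzBoundary {n : ℕ} (U : Set (EuclideanSpace ℝ (Fin n))) : Prop :=
  ∀ p ∈ frontier U, ∃ ν : EuclideanSpace ℝ (Fin n), ‖ν‖ = 1 ∧
    ∃ (L : ℝ≥0) (g : ↥(ℝ ∙ ν)ᗮ → ℝ), LipschitzWith L g ∧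
      ∃ r > 0, ∀ x ∈ Metric.ball p r,
        x ∈ U ↔ g ((ℝ ∙ ν)ᗮ.orthogonalProjectionOnto x) < ⟪ν, x⟫_ℝ

/-- A bounded hypersurface `Σ ⊆ ℝⁿ⁺¹` with boundary, given by one global chart
`α : Σ → Σ̂ ⊆ ℝⁿ`.  The data are the bounded open set `Σ̂ = chart` with Lipschitz boundary and the
inverse `α⁻¹ = param`; the latter is a `C¹` diffeomorphism onto its image up to the boundary,
that is, an injective `C¹` immersion of the closure of `Σ̂`. -/
structure BoundedHypersurface (n : ℕ) where
  chart : Set (EuclideanSpace ℝ (Fin n))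
  param : EuclideanSpace ℝ (Fin n) → EuclideanSpace ℝ (Fin (n + 1))
  isOpen_chart : IsOpen chart
  isBounded_chart : Bornology.IsBounded chart
  lipschitz_chart : HasLipschitzBoundary chart
  contDiff_param : ∃ V, IsOpen V ∧ closure chart ⊆ V ∧ ContDiffOn ℝ 1 param V
  injOn_param : InjOn param (closure chart)
  immersion_param : ∀ x ∈ closure chart, Function.Injective (fderiv ℝ param x)

namespace BoundedHypersurface

variable {n : ℕ} (S : BoundedHypersurface n)

/-- The hypersurface `Σ` as a subset of `ℝⁿ⁺¹`.  Functions on `Σ` are written below as functions on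
`ℝⁿ⁺¹`; only their values on `Σ` are ever used. -/
def carrier : Set (EuclideanSpace ℝ (Fin (n + 1))) := S.param '' S.chart

/-- The boundary `γ = ∂Σ`. -/
def boundary : Set (EuclideanSpace ℝ (Fin (n + 1))) := S.param '' frontier S.chart

/-- The chart `α : Σ → Σ̂`, the inverse of `param` (with arbitrary values off `Σ`). -/
def alpha : EuclideanSpace ℝ (Fin (n + 1)) → EuclideanSpace ℝ (Fin n) :=
  Function.invFunOn S.param S.chart

/-- `w` is a weight on `Σ`: `w ∘ α⁻¹` is the restriction to `Σ̂` of a locally integrable and almost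
everywhere positive function on `ℝⁿ`. -/
def IsWeight (w : EuclideanSpace ℝ (Fin (n + 1)) → ℝ) : Prop :=
  ∃ what : EuclideanSpace ℝ (Fin n) → ℝ, LocallyIntegrable what volume ∧
    (∀ᵐ x ∂(volume : Measure (EuclideanSpace ℝ (Fin n))), 0 < what x) ∧
    ∀ x ∈ S.chart, what x = w (S.param x)

/-- A property holds almost everywhere on `Σ`. -/
def AEOn (P : EuclideanSpace ℝ (Fin (n + 1)) → Prop) : Prop :=
  ∀ᵐ x ∂(volume.restrict S.chart), P (S.param x)

/-- The weighted norm `‖v‖_{0,w,Σ} = (∫_{Σ̂} |v ∘ α⁻¹|² (w ∘ α⁻¹) dx)^{1/2}`, as an extended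
nonnegative number, for scalar or vector valued `v`. -/
def weightedNorm {F : Type*} [NormedAddCommGroup F]
    (w : EuclideanSpace ℝ (Fin (n + 1)) → ℝ) (v : EuclideanSpace ℝ (Fin (n + 1)) → F) : ℝ≥0∞ :=
  (∫⁻ x in S.chart, ‖v (S.param x)‖ₑ ^ 2 * ENNReal.ofReal (w (S.param x))) ^ (1 / 2 : ℝ)

/-- The first fundamental form `g = (Dα⁻¹)ᵀ Dα⁻¹` in the chart, as an operator on `ℝⁿ`. -/
def firstFundamentalForm (x : EuclideanSpace ℝ (Fin n)) :
    EuclideanSpace ℝ (Fin n) →L[ℝ] EuclideanSpace ℝ (Fin n) :=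
  (ContinuousLinearMap.adjoint (fderiv ℝ S.param x)).comp (fderiv ℝ S.param x)

/-- The tangential gradient `∇_τ u`, in the chart `Dα⁻¹ (g⁻¹ ∇(u ∘ α⁻¹))`. -/
def tangentialGradient (u : EuclideanSpace ℝ (Fin (n + 1)) → ℝ)
    (s : EuclideanSpace ℝ (Fin (n + 1))) : EuclideanSpace ℝ (Fin (n + 1)) :=
  fderiv ℝ S.param (S.alpha s)
    ((S.firstFundamentalForm (S.alpha s)).inverse (gradient (u ∘ S.param) (S.alpha s)))

/-- `u ∈ C_0^∞(Σ)`: smooth in the chart and vanishing off a compact subset of `Σ`. -/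
def IsTestFunction (u : EuclideanSpace ℝ (Fin (n + 1)) → ℝ) : Prop :=
  ContDiffOn ℝ ∞ (u ∘ S.param) S.chart ∧
    ∃ K ⊆ S.carrier, IsCompact K ∧ ∀ s ∈ S.carrier, s ∉ K → u s = 0

/-- The assumptions on the aperture function `b`, with cutoff function `χ` and profile `f`. -/
structure ApertureAssumptions (b χ f : EuclideanSpace ℝ (Fin (n + 1)) → ℝ) : Prop where
  /-- A1: `b` is a weight on `Σ`. -/
  weight : S.IsWeight b
  /-- A2: `χ` is a smooth cutoff function that is `1` near the boundary `γ`, ... -/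
  smooth_cutoff : ContDiff ℝ ∞ χ
  cutoff_mem : ∀ y, χ y ∈ Icc (0 : ℝ) 1
  cutoff_eq_one : ∀ᶠ y in 𝓝ˢ S.boundary, χ y = 1
  /-- ... `f` is integrable on `Σ`, ... -/
  integrable_profile : IntegrableOn (fun x => f (S.param x)) S.chart
  /-- ... and `b = c (χ dist^{1/2} + (1 - χ) f)` with `dist` the distance in `ℝⁿ⁺¹` to `γ`. -/
  formula : ∃ c > 0, S.AEOn fun s =>
    b s = c * (χ s * Real.sqrt (Metric.infDist s S.boundary) + (1 - χ s) * f s)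
  /-- A3: `b` is essentially bounded. -/
  bounded : ∃ bmax > 0, S.AEOn fun s => |b s| ≤ bmax
  /-- A4: `f` is essentially bounded from below away from zero. -/
  profile_lower : ∃ a > 0, S.AEOn fun s => a ≤ f s

/-- The chart inverts the parametrization on `Σ̂`. -/
theorem alpha_param {x : EuclideanSpace ℝ (Fin n)} (hx : x ∈ S.chart) :
    S.alpha (S.param x) = x :=
  (S.injOn_param.mono subset_closure).leftInvOn_invFunOn hx

/-- The first fundamental form is invertible on `Σ̂`. -/
theorem firstFundamentalForm_inverse {x : EuclideanSpace ℝ (Fin n)} (hx : x ∈ S.chart)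
    (v : EuclideanSpace ℝ (Fin n)) :
    S.firstFundamentalForm x ((S.firstFundamentalForm x).inverse v) = v := by
  have hinj : Function.Injective (S.firstFundamentalForm x) := by
    rw [injective_iff_map_eq_zero]
    intro w hw
    have h : ⟪S.firstFundamentalForm x w, w⟫_ℝ = 0 := by rw [hw, inner_zero_left]
    rw [firstFundamentalForm, ContinuousLinearMap.comp_apply,
      ContinuousLinearMap.adjoint_inner_left, inner_self_eq_zero] at h
    exact (injective_iff_map_eq_zero _).1 (S.immersion_param x (subset_closure hx)) w h
  let e := LinearEquiv.ofInjectiveEndo (S.firstFundamentalForm x).toLinearMap hinj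
  have he : S.firstFundamentalForm x = (e.toContinuousLinearEquiv : _ →L[ℝ] _) := by
    ext1 w; rfl
  rw [he, ContinuousLinearMap.inverse_equiv]
  simp

/-- For a function `u` differentiable in the ambient space, `∇_τ u` is the orthogonal projection of
`∇u` to the tangent space of `Σ`. -/
theorem tangentialGradient_eq_projection {u : EuclideanSpace ℝ (Fin (n + 1)) → ℝ}
    {x : EuclideanSpace ℝ (Fin n)} (hx : x ∈ S.chart) (hu : DifferentiableAt ℝ u (S.param x)) :
    S.tangentialGradient u (S.param x) =
      (LinearMap.range (fderiv ℝ S.param x).toLinearMap).starProjection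
        (gradient u (S.param x)) := by
  have hp : DifferentiableAt ℝ S.param x := by
    obtain ⟨V, hV, hsub, hc⟩ := S.contDiff_param
    exact (hc.differentiableOn (by norm_num)).differentiableAt
      (hV.mem_nhds (hsub (subset_closure hx)))
  symm
  apply Submodule.eq_starProjection_of_mem_of_inner_eq_zero
  · rw [tangentialGradient, S.alpha_param hx]
    exact ⟨_, rfl⟩
  · rintro _ ⟨h, rfl⟩
    rw [tangentialGradient, S.alpha_param hx, inner_sub_left]
    have h1 := S.firstFundamentalForm_inverse hx (gradient (u ∘ S.param) x)
    have h2 := congrArg (fun w => ⟪w, h⟫_ℝ) h1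
    simp only [firstFundamentalForm, ContinuousLinearMap.comp_apply,
      ContinuousLinearMap.adjoint_inner_left] at h2
    simp only [firstFundamentalForm, ContinuousLinearMap.coe_coe]
    rw [h2, gradient, gradient, InnerProductSpace.toDual_symm_apply,
      InnerProductSpace.toDual_symm_apply, fderiv_comp x hu hp]
    simp

end BoundedHypersurface

end

/-!
Write `d` for the distance to `∂Σ̂` in `ℝⁿ`. The inequality is transferred to the chart, where it
reads `∫ |v|² d^{-1/2} ≤ C ∫ |Dv|² d^{1/2}` for `C¹` functions `v` on `ℝⁿ` that vanish off `Σ̂`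
(`HasLipschitzBoundary.weightedPoincareOn`).

The transfer rests on two facts. The parametrization is bi-Lipschitz on the closure of `Σ̂`
(`IsCompact.exists_mul_dist_le_of_injOn_immersion`), so the distance to `γ` dominates a multiple of
`d`; together with the lower bound on the profile this gives `b ≥ κ d^{1/2}` almost everywhere
(`BoundedHypersurface.ApertureAssumptions.exists_mul_sqrt_infDist_le`). And the tangential gradient
is comparable to the gradient in the chart, with constants given by the bounds on the differential
of the parametrization.

The inequality in the chart is local, by compactness of the closure of `Σ̂`: near each point the
mass has to be bounded by the energy on all of `Σ̂`.
* Near a boundary point, `Σ̂` is an epigraph, and `d` is comparable to the height `h` over the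
  graph. Integrating along the segment of length `h` from `x` down to the graph, where `v` vanishes,
  and applying the Cauchy–Schwarz inequality with weight `(h - τ)^{1/2}` gives
  `|v(x)|² ≤ 2 h^{1/2} ∫₀^h |Dv(x - τν)|² (h - τ)^{1/2} dτ`, where `ν` is the upward direction
  (`sq_le_segment_energy`). The factor `h^{1/2}` absorbs the weight `d(x)^{-1/2}`, and integrating
  over `x` only uses the translation invariance of Lebesgue measure
  (`lintegral_lintegral_segment_le`).
* A small ball about an interior point is translated towards a nearest boundary point until it lies
  in a region of the first kind; the translates stay away from the boundary, so the difference is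
  controlled by the energy (`WeightedPoincareOn.exists_ball_of_mem`).
-/

/-! ### Integrals along segments -/

section Segments

variable {E : Type*} [NormedAddCommGroup E] [NormedSpace ℝ E]

theorem enorm_le_add_lintegral_segment {v : E → ℝ} (hv : ContDiff ℝ 1 v) (x e : E) {h : ℝ}
    (hh : 0 ≤ h) :
    ‖v x‖ₑ ≤ ‖v (x + h • e)‖ₑ + ‖e‖ₑ * ∫⁻ τ in Ioo 0 h, ‖fderiv ℝ v (x + τ • e)‖ₑ := by
  have hcont : Continuous fun τ : ℝ => fderiv ℝ v (x + τ • e) :=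
    (hv.continuous_fderiv one_ne_zero).comp (by fun_prop)
  have hderiv : ∀ τ ∈ uIcc 0 h,
      HasDerivAt (fun τ : ℝ => v (x + τ • e)) (fderiv ℝ v (x + τ • e) e) τ := by
    intro τ _
    have h1 : HasDerivAt (fun τ : ℝ => x + τ • e) e τ := by
      simpa using ((hasDerivAt_id τ).smul_const e).const_add x
    exact ((hv.differentiable one_ne_zero).differentiableAt.hasFDerivAt).comp_hasDerivAt τ h1
  have hftc := intervalIntegral.integral_eq_sub_of_hasDerivAt hderiv
    ((hcont.clm_apply continuous_const).intervalIntegrable 0 h)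
  have hx : v x = v (x + h • e) - ∫ τ in (0 : ℝ)..h, fderiv ℝ v (x + τ • e) e := by
    rw [hftc]; simp
  rw [hx, intervalIntegral.integral_of_le hh, integral_Ioc_eq_integral_Ioo]
  refine enorm_sub_le.trans (add_le_add le_rfl ((enorm_integral_le_lintegral_enorm _).trans ?_))
  rw [← lintegral_const_mul _ hcont.enorm.measurable]
  exact lintegral_mono fun τ => by
    rw [mul_comm]; exact ContinuousLinearMap.le_opENorm _ _

/-- The weighted Cauchy–Schwarz inequality. -/
theorem lintegral_sq_le_weighted {α : Type*} [MeasurableSpace α] {μ : Measure α}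
    {f w : α → ℝ≥0∞} (hf : AEMeasurable f μ) (hw : AEMeasurable w μ)
    (hw0 : ∀ᵐ a ∂μ, w a ≠ 0) (hwt : ∀ᵐ a ∂μ, w a ≠ ⊤) :
    (∫⁻ a, f a ∂μ) ^ 2 ≤ (∫⁻ a, f a ^ 2 * w a ∂μ) * ∫⁻ a, (w a)⁻¹ ∂μ := by
  have h1 : ∫⁻ a, f a ∂μ
      = ∫⁻ a, ((f * fun a => w a ^ (1 / 2 : ℝ)) * fun a => w⁻¹ a ^ (1 / 2 : ℝ)) a ∂μ := by
    refine lintegral_congr_ae ?_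
    filter_upwards [hw0, hwt] with a h0 ht
    rw [Pi.mul_apply, Pi.mul_apply, Pi.inv_apply, mul_assoc,
      ← ENNReal.mul_rpow_of_nonneg _ _ (by norm_num),
      ENNReal.mul_inv_cancel h0 ht, ENNReal.one_rpow, mul_one]
  have h2 := ENNReal.lintegral_mul_le_Lp_mul_Lq μ Real.HolderConjugate.two_two
    (hf.mul (hw.pow_const (1 / 2 : ℝ))) (hw.inv.pow_const (1 / 2 : ℝ))
  rw [← h1] at h2
  have key : ∀ t : ℝ≥0∞, (t ^ (1 / 2 : ℝ)) ^ 2 = t := fun t => by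
    rw [← ENNReal.rpow_natCast, ← ENNReal.rpow_mul]; norm_num
  calc (∫⁻ a, f a ∂μ) ^ 2 ≤ _ := pow_le_pow_left₀ zero_le h2 2
    _ = _ := by
      rw [mul_pow, key, key]
      simp only [ENNReal.rpow_two, mul_pow, key, Pi.mul_apply, Pi.inv_apply]

theorem lintegral_inv_sqrt_sub {h : ℝ} (hh : 0 ≤ h) :
    ∫⁻ τ in Ioo 0 h, (ENNReal.ofReal √(h - τ))⁻¹ = ENNReal.ofReal (2 * √h) := by
  have hint : IntervalIntegrable (fun τ : ℝ => (h - τ) ^ (-(1 / 2) : ℝ)) volume 0 h := by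
    have := (intervalIntegral.intervalIntegrable_rpow' (a := h) (b := 0)
      (r := -(1 / 2)) (by norm_num)).comp_sub_left h
    simpa using this
  have hval : ∫ τ in (0 : ℝ)..h, (h - τ) ^ (-(1 / 2) : ℝ) = 2 * √h := by
    rw [intervalIntegral.integral_comp_sub_left (fun t => t ^ (-(1 / 2) : ℝ)) h, sub_self,
      sub_zero, integral_rpow (Or.inl (by norm_num)), Real.sqrt_eq_rpow]
    norm_num
    ring
  rw [intervalIntegral.integral_of_le hh, integral_Ioc_eq_integral_Ioo] at hval
  rw [intervalIntegrable_iff_integrableOn_Ioo_of_le hh] at hint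
  rw [← hval, ofReal_integral_eq_lintegral_ofReal hint]
  · refine setLIntegral_congr_fun measurableSet_Ioo fun τ hτ => ?_
    have hpos : 0 < h - τ := sub_pos.2 hτ.2
    rw [← ENNReal.ofReal_inv_of_pos (Real.sqrt_pos.2 hpos), Real.rpow_neg hpos.le,
      Real.sqrt_eq_rpow]
  · filter_upwards [ae_restrict_mem measurableSet_Ioo] with τ hτ
    exact Real.rpow_nonneg (sub_nonneg.2 hτ.2.le) _

/-- Integrating over `x` the integral of `G` over the segment from `x` to `x + h e` costs only a
factor `h`, since Lebesgue measure is invariant under each translation by `τ e`. -/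
theorem lintegral_lintegral_segment_le [FiniteDimensional ℝ E] [MeasureSpace E] [BorelSpace E]
    [(volume : Measure E).IsAddHaarMeasure]
    {G : E → ℝ≥0∞} (hG : Measurable G) (A : Set E) (e : E) (h : ℝ) :
    ∫⁻ x in A, ∫⁻ τ in Ioo 0 h, G (x + τ • e) ≤ ENNReal.ofReal h * ∫⁻ x, G x := by
  have : ProperSpace E := FiniteDimensional.proper ℝ E
  calc ∫⁻ x in A, ∫⁻ τ in Ioo 0 h, G (x + τ • e)
      ≤ ∫⁻ x, ∫⁻ τ in Ioo 0 h, G (x + τ • e) := setLIntegral_le_lintegral _ _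
    _ = ∫⁻ τ in Ioo 0 h, ∫⁻ x, G (x + τ • e) := by
        refine lintegral_lintegral_swap (Measurable.aemeasurable ?_)
        exact hG.comp (by fun_prop)
    _ = ENNReal.ofReal h * ∫⁻ x, G x := by
        simp only [lintegral_add_right_eq_self, lintegral_const, Measure.restrict_apply_univ,
          Real.volume_Ioo, sub_zero]
        rw [mul_comm]

end Segments

/-! ### The weighted inequality on a bounded Lipschitz domain -/

section LipschitzDomain

variable {n : ℕ} {U : Set (EuclideanSpace ℝ (Fin n))}

/-- The energy `∫_U |Dv|² d^{1/2}`, where `d` is the distance to the boundary of `U`. -/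
noncomputable def weightedEnergy (U : Set (EuclideanSpace ℝ (Fin n)))
    (v : EuclideanSpace ℝ (Fin n) → ℝ) : ℝ≥0∞ :=
  ∫⁻ x in U, ‖fderiv ℝ v x‖ₑ ^ 2 * ENNReal.ofReal √(Metric.infDist x (frontier U))

/-- The square integral `∫_{U ∩ s} |v|² d^{-1/2}`, where `d` is the distance to the boundary
of `U`. -/
noncomputable def weightedMass (U s : Set (EuclideanSpace ℝ (Fin n)))
    (v : EuclideanSpace ℝ (Fin n) → ℝ) : ℝ≥0∞ :=
  ∫⁻ x in U ∩ s, ‖v x‖ₑ ^ 2 * ENNReal.ofReal (√(Metric.infDist x (frontier U)))⁻¹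

/-- The weighted inequality holds on the part of `U` in `s`: the mass on `U ∩ s` is controlled by
the energy on all of `U`, for functions that vanish off `U`. -/
def WeightedPoincareOn (U s : Set (EuclideanSpace ℝ (Fin n))) : Prop :=
  ∃ C : ℝ≥0∞, C ≠ ⊤ ∧ ∀ v : EuclideanSpace ℝ (Fin n) → ℝ, ContDiff ℝ 1 v →
    (∀ x ∉ U, v x = 0) → weightedMass U s v ≤ C * weightedEnergy U v

theorem WeightedPoincareOn.empty : WeightedPoincareOn U ∅ :=
  ⟨0, ENNReal.zero_ne_top, fun v _ _ => by simp [weightedMass]⟩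

theorem WeightedPoincareOn.mono {s t : Set (EuclideanSpace ℝ (Fin n))} (hst : s ⊆ t)
    (ht : WeightedPoincareOn U t) : WeightedPoincareOn U s := by
  obtain ⟨C, hC, h⟩ := ht
  exact ⟨C, hC, fun v hv h0 =>
    (lintegral_mono_set (inter_subset_inter_right U hst)).trans (h v hv h0)⟩

theorem WeightedPoincareOn.union {s t : Set (EuclideanSpace ℝ (Fin n))}
    (hs : WeightedPoincareOn U s) (ht : WeightedPoincareOn U t) :
    WeightedPoincareOn U (s ∪ t) := by
  obtain ⟨C, hC, h⟩ := hs
  obtain ⟨D, hD, h'⟩ := ht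
  refine ⟨C + D, ENNReal.add_ne_top.2 ⟨hC, hD⟩, fun v hv h0 => ?_⟩
  rw [weightedMass, inter_union_distrib_left, add_mul]
  exact (lintegral_union_le _ _ _).trans (add_le_add (h v hv h0) (h' v hv h0))

theorem measurable_energyDensity {v : EuclideanSpace ℝ (Fin n) → ℝ} (hv : ContDiff ℝ 1 v) :
    Measurable fun x => ‖fderiv ℝ v x‖ₑ ^ 2 * ENNReal.ofReal √(Metric.infDist x (frontier U)) := by
  have h1 : Continuous fun x => fderiv ℝ v x := hv.continuous_fderiv one_ne_zero
  have h2 : Measurable fun x => ‖fderiv ℝ v x‖ₑ := h1.enorm.measurable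
  have h3 : Measurable fun x => ENNReal.ofReal √(Metric.infDist x (frontier U)) :=
    (Real.continuous_sqrt.comp (Metric.continuous_infDist_pt _)).measurable.ennreal_ofReal
  exact (h2.pow_const 2).mul h3

/-- In one dimension: if `v` vanishes at the end of a segment of length `h` issuing from `x`, and
the distance to the boundary is at least `κ` times the remaining length along it, then `v x` is
controlled by the weighted energy density on the segment. -/
theorem sq_le_segment_energy {v : EuclideanSpace ℝ (Fin n) → ℝ} (hv : ContDiff ℝ 1 v)
    {x e : EuclideanSpace ℝ (Fin n)} (he : ‖e‖ = 1) {h κ : ℝ} (hh : 0 < h) (hκ : 0 < κ)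
    (hend : v (x + h • e) = 0) (hmem : ∀ τ ∈ Ioo 0 h, x + τ • e ∈ U)
    (hd : ∀ τ ∈ Ico 0 h, κ * (h - τ) ≤ Metric.infDist (x + τ • e) (frontier U)) :
    ‖v x‖ₑ ^ 2 * ENNReal.ofReal (√(Metric.infDist x (frontier U)))⁻¹ ≤
      ENNReal.ofReal (2 / κ) * ∫⁻ τ in Ioo 0 h, U.indicator (fun y => ‖fderiv ℝ v y‖ₑ ^ 2 *
        ENNReal.ofReal √(Metric.infDist y (frontier U))) (x + τ • e) := by
  set I := ∫⁻ τ in Ioo 0 h, U.indicator (fun y => ‖fderiv ℝ v y‖ₑ ^ 2 *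
        ENNReal.ofReal √(Metric.infDist y (frontier U))) (x + τ • e) with hI
  have hcont : Continuous fun τ : ℝ => fderiv ℝ v (x + τ • e) :=
    (hv.continuous_fderiv one_ne_zero).comp (by fun_prop)
  have h1 : ‖v x‖ₑ ≤ ∫⁻ τ in Ioo 0 h, ‖fderiv ℝ v (x + τ • e)‖ₑ := by
    have := enorm_le_add_lintegral_segment hv x e hh.le
    have he' : ‖e‖ₑ = 1 := by rw [← ofReal_norm, he, ENNReal.ofReal_one]
    simpa [hend, he'] using this
  have hmeas : Measurable fun τ : ℝ => ENNReal.ofReal √(h - τ) := by fun_prop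
  have h2 := lintegral_sq_le_weighted (μ := volume.restrict (Ioo 0 h))
    (f := fun τ => ‖fderiv ℝ v (x + τ • e)‖ₑ) (w := fun τ => ENNReal.ofReal √(h - τ))
    hcont.enorm.aemeasurable hmeas.aemeasurable
    (by
      filter_upwards [ae_restrict_mem measurableSet_Ioo] with τ hτ
      simpa using hτ.2)
    (Filter.Eventually.of_forall fun _ => ENNReal.ofReal_ne_top)
  rw [lintegral_inv_sqrt_sub hh.le] at h2
  have hsκ : 0 < √κ := Real.sqrt_pos.2 hκ
  have h3 : ∫⁻ τ in Ioo 0 h, ‖fderiv ℝ v (x + τ • e)‖ₑ ^ 2 * ENNReal.ofReal √(h - τ)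
      ≤ ENNReal.ofReal (√κ)⁻¹ * I := by
    rw [hI, ← lintegral_const_mul' _ _ ENNReal.ofReal_ne_top]
    refine setLIntegral_mono_ae' measurableSet_Ioo (Filter.Eventually.of_forall fun τ hτ => ?_)
    rw [indicator_of_mem (hmem τ hτ), mul_left_comm, ← ENNReal.ofReal_mul (by positivity)]
    gcongr
    rw [inv_mul_eq_div, le_div_iff₀ hsκ, mul_comm, ← Real.sqrt_mul hκ.le]
    exact Real.sqrt_le_sqrt (hd τ ⟨hτ.1.le, hτ.2⟩)
  have hd0 : κ * h ≤ Metric.infDist x (frontier U) := by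
    simpa using hd 0 ⟨le_rfl, hh⟩
  have h4 : 2 * √h * (√(Metric.infDist x (frontier U)))⁻¹ ≤ 2 * (√κ)⁻¹ := by
    have hs : √κ * √h ≤ √(Metric.infDist x (frontier U)) := by
      rw [← Real.sqrt_mul hκ.le]; exact Real.sqrt_le_sqrt hd0
    have hpos : 0 < √h := Real.sqrt_pos.2 hh
    have : 0 < √(Metric.infDist x (frontier U)) := lt_of_lt_of_le (by positivity) hs
    rw [← div_eq_mul_inv, ← div_eq_mul_inv, div_le_div_iff₀ this hsκ]
    nlinarith
  calc ‖v x‖ₑ ^ 2 * ENNReal.ofReal (√(Metric.infDist x (frontier U)))⁻¹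
      ≤ (ENNReal.ofReal (√κ)⁻¹ * I * ENNReal.ofReal (2 * √h)) *
        ENNReal.ofReal (√(Metric.infDist x (frontier U)))⁻¹ := by
        gcongr
        exact (pow_le_pow_left₀ zero_le h1 2).trans (h2.trans (by gcongr))
    _ = ENNReal.ofReal ((√κ)⁻¹ * (2 * √h * (√(Metric.infDist x (frontier U)))⁻¹)) * I := by
        rw [ENNReal.ofReal_mul (p := (√κ)⁻¹) (by positivity),
          ENNReal.ofReal_mul (p := 2 * √h) (by positivity)]
        ring
    _ ≤ ENNReal.ofReal (2 / κ) * I := by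
        gcongr
        calc (√κ)⁻¹ * (2 * √h * (√(Metric.infDist x (frontier U)))⁻¹)
            ≤ (√κ)⁻¹ * (2 * (√κ)⁻¹) := by gcongr
          _ = 2 / κ := by
            rw [mul_left_comm, ← mul_inv, Real.mul_self_sqrt hκ.le, div_eq_mul_inv]

/-- Near a boundary point, points of `U` are joined to the complement of `U` by segments in the
direction opposite to that in which `U` is an epigraph. Their length is comparable to the distance
to the boundary because the height over the graph is a Lipschitz function. -/
theorem HasLipschitzBoundary.weightedPoincareOn_ball (hU : IsOpen U)
    (hL : HasLipschitzBoundary U) {p : EuclideanSpace ℝ (Fin n)} (hp : p ∈ frontier U) :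
    ∃ r > 0, WeightedPoincareOn U (Metric.ball p r) := by
  obtain ⟨ν, hν, L, g, hg, r, hr, hgr⟩ := hL p hp
  set P := (ℝ ∙ ν)ᗮ.orthogonalProjectionOnto with hP
  -- the height over the graph
  let H : EuclideanSpace ℝ (Fin n) → ℝ := fun x => ⟪ν, x⟫_ℝ - g (P x)
  have hHlip : ∀ x y, H x - H y ≤ (1 + L) * dist x y := by
    intro x y
    have h1 : ⟪ν, x⟫_ℝ - ⟪ν, y⟫_ℝ ≤ dist x y := by
      rw [← inner_sub_right, dist_eq_norm]
      simpa [hν] using real_inner_le_norm ν (x - y)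
    have h2 : dist (P y) (P x) ≤ dist x y := by
      rw [dist_comm x y, dist_eq_norm, ← map_sub, dist_eq_norm]
      exact Submodule.norm_orthogonalProjectionOnto_apply_le _ _
    have h3 : g (P y) - g (P x) ≤ L * dist x y :=
      (le_abs_self _).trans ((hg.dist_le_mul _ _).trans (by gcongr))
    simp only [H]
    linarith
  have hHray : ∀ x τ, H (x + τ • (-ν)) = H x - τ := by
    intro x τ
    have h1 : P (x + τ • (-ν)) = P x := by
      have : P ν = 0 := by
        rw [hP]
        exact Submodule.orthogonalProjectionOnto_orthogonal_apply_eq_zero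
          (Submodule.mem_span_singleton_self ν)
      simp [this]
    simp only [H, h1, inner_add_right, inner_smul_right, inner_neg_right,
      real_inner_self_eq_norm_sq, hν]
    ring
  have hHpos : ∀ x ∈ Metric.ball p r, (x ∈ U ↔ 0 < H x) := by
    intro x hx
    rw [hgr x hx, sub_pos]
  have hfront : ∀ y ∈ frontier U, y ∉ U := by
    intro y hy
    rw [hU.frontier_eq] at hy
    exact hy.2
  have hpr : p ∈ Metric.ball p r := Metric.mem_ball_self hr
  have hHp : H p ≤ 0 := not_lt.1 fun h => hfront p hp ((hHpos p hpr).2 h)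
  have hL1 : (0 : ℝ) < 1 + L := by positivity
  have hHd : ∀ x ∈ Metric.ball p (r / 2),
      (1 + L : ℝ)⁻¹ * H x ≤ Metric.infDist x (frontier U) := by
    intro x hx
    obtain ⟨y, hy, hxy⟩ := isClosed_frontier.exists_infDist_eq_dist ⟨p, hp⟩ x
    have hyr : y ∈ Metric.ball p r := by
      have h1 : Metric.infDist x (frontier U) ≤ dist x p := Metric.infDist_le_dist_of_mem hp
      have h2 := dist_triangle_left y p x
      rw [Metric.mem_ball] at hx ⊢
      linarith
    have hHy : H y ≤ 0 := not_lt.1 fun h => hfront y hy ((hHpos y hyr).2 h)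
    rw [hxy, inv_mul_le_iff₀ hL1]
    linarith [hHlip x y]
  -- a point at distance `ρ` from `p` has height at most `(1 + L) ρ`, so its whole segment
  -- stays within distance `(2 + L) ρ` of `p`
  have hρ : 0 < r / (2 * (2 + L)) := by positivity
  refine ⟨r / (2 * (2 + L)), hρ, ENNReal.ofReal (2 / (1 + L : ℝ)⁻¹) * ENNReal.ofReal r,
    ENNReal.mul_ne_top ENNReal.ofReal_ne_top ENNReal.ofReal_ne_top, fun v hv h0 => ?_⟩
  have hG := (measurable_energyDensity (U := U) hv).indicator hU.measurableSet
  have hpt : ∀ x ∈ U ∩ Metric.ball p (r / (2 * (2 + L))),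
      ‖v x‖ₑ ^ 2 * ENNReal.ofReal (√(Metric.infDist x (frontier U)))⁻¹ ≤
      ENNReal.ofReal (2 / (1 + L : ℝ)⁻¹) * ∫⁻ τ in Ioo 0 r, U.indicator (fun y =>
        ‖fderiv ℝ v y‖ₑ ^ 2 * ENNReal.ofReal √(Metric.infDist y (frontier U))) (x + τ • (-ν)) := by
    rintro x ⟨hxU, hx⟩
    rw [Metric.mem_ball, lt_div_iff₀ (by positivity)] at hx
    have hL0 : (0 : ℝ) ≤ L := L.2
    have hd0 : 0 ≤ dist x p := dist_nonneg
    have hHx : H x ≤ (1 + L) * dist x p := by linarith [hHlip x p]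
    have hball : ∀ τ ∈ Icc 0 (H x), x + τ • (-ν) ∈ Metric.ball p (r / 2) := by
      intro τ hτ
      have h1 : dist (x + τ • (-ν)) x = τ := by
        rw [dist_eq_norm, add_sub_cancel_left, norm_smul, norm_neg, hν, mul_one, Real.norm_eq_abs,
          abs_of_nonneg hτ.1]
      have h2 := dist_triangle (x + τ • (-ν)) x p
      rw [Metric.mem_ball]
      nlinarith [hτ.2]
    have hball' : ∀ τ ∈ Icc 0 (H x), x + τ • (-ν) ∈ Metric.ball p r := fun τ hτ =>
      Metric.ball_subset_ball (by linarith) (hball τ hτ)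
    have hH0 : 0 < H x := (hHpos x (by rw [Metric.mem_ball]; nlinarith)).1 hxU
    refine (sq_le_segment_energy (h := H x) hv (by rwa [norm_neg]) hH0 (inv_pos.2 hL1) ?_ ?_
      ?_).trans ?_
    · refine h0 _ fun hmem => ?_
      have := (hHpos _ (hball' _ ⟨hH0.le, le_rfl⟩)).1 hmem
      rw [hHray] at this
      linarith
    · intro τ hτ
      refine (hHpos _ (hball' τ ⟨hτ.1.le, hτ.2.le⟩)).2 ?_
      rw [hHray]
      linarith [hτ.2]
    · intro τ hτ
      rw [← hHray]
      exact hHd _ (hball τ ⟨hτ.1, hτ.2.le⟩)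
    · gcongr
      nlinarith
  calc weightedMass U (Metric.ball p (r / (2 * (2 + L)))) v ≤ _ :=
        setLIntegral_mono_ae' (hU.measurableSet.inter measurableSet_ball)
          (Filter.Eventually.of_forall hpt)
    _ = ENNReal.ofReal (2 / (1 + L : ℝ)⁻¹) * _ := lintegral_const_mul' _ _ ENNReal.ofReal_ne_top
    _ ≤ ENNReal.ofReal (2 / (1 + L : ℝ)⁻¹) * (ENNReal.ofReal r * _) := by
        gcongr
        exact lintegral_lintegral_segment_le hG _ _ _
    _ = _ := by rw [lintegral_indicator hU.measurableSet, weightedEnergy, mul_assoc]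

theorem infDist_frontier_le_diam (hb : Bornology.IsBounded U)
    (hne : (frontier U).Nonempty) {x : EuclideanSpace ℝ (Fin n)} (hx : x ∈ U) :
    Metric.infDist x (frontier U) ≤ Metric.diam (closure U) := by
  obtain ⟨q, hq⟩ := hne
  exact (Metric.infDist_le_dist_of_mem hq).trans
    (Metric.dist_le_diam_of_mem hb.closure (subset_closure hx) hq.1)

theorem infDist_frontier_pos (hU : IsOpen U) (hne : (frontier U).Nonempty)
    {x : EuclideanSpace ℝ (Fin n)} (hx : x ∈ U) : 0 < Metric.infDist x (frontier U) := by
  refine (isClosed_frontier.notMem_iff_infDist_pos hne).1 fun hxf => ?_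
  rw [hU.frontier_eq] at hxf
  exact hxf.2 hx

theorem ball_infDist_frontier_subset {x : EuclideanSpace ℝ (Fin n)} (hU : IsOpen U)
    (hx : x ∈ U) : Metric.ball x (Metric.infDist x (frontier U)) ⊆ U := by
  by_cases hr : 0 < Metric.infDist x (frontier U)
  · refine (convex_ball x _).isPreconnected.subset_left_of_subset_union hU
      isClosed_closure.isOpen_compl (disjoint_compl_right.mono_left subset_closure) ?_
      ⟨x, Metric.mem_ball_self hr, hx⟩
    intro y hy
    by_contra hnot
    have hyf : y ∈ frontier U := by
      rw [hU.frontier_eq]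
      exact ⟨not_not.1 fun h => hnot (Or.inr h), fun h => hnot (Or.inl h)⟩
    have := Metric.infDist_le_dist_of_mem (x := x) hyf
    rw [dist_comm] at this
    exact absurd (Metric.mem_ball.1 hy) (not_lt.2 this)
  · rw [Metric.ball_eq_empty.2 (not_lt.1 hr)]
    exact empty_subset _

/-- The mass in a small ball about an interior point is controlled by translating the ball towards
a nearest boundary point `q`, where the inequality is known; the translates stay away from the
boundary, hence the weight is bounded below on them. -/
theorem WeightedPoincareOn.exists_ball_of_mem (hU : IsOpen U)
    (hq : ∀ q ∈ frontier U, ∃ r > 0, WeightedPoincareOn U (Metric.ball q r))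
    (hb : Bornology.IsBounded U) (hne : (frontier U).Nonempty)
    {x : EuclideanSpace ℝ (Fin n)} (hx : x ∈ U) :
    ∃ r > 0, WeightedPoincareOn U (Metric.ball x r) := by
  obtain ⟨q, hqf, hxq⟩ := isClosed_frontier.exists_infDist_eq_dist hne x
  obtain ⟨ρ, hρ, C, hC, hCv⟩ := hq q hqf
  set δ := dist x q with hδ
  have hδ0 : 0 < δ := by
    rw [hδ, dist_pos]
    rintro rfl
    rw [hU.frontier_eq] at hqf
    exact hqf.2 hx
  obtain ⟨ε, hε, h3ε, h2ε⟩ : ∃ ε > 0, 3 * ε ≤ ρ ∧ 2 * ε ≤ δ :=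
    ⟨min (ρ / 3) (δ / 2), by positivity, by linarith [min_le_left (ρ / 3) (δ / 2)],
      by linarith [min_le_right (ρ / 3) (δ / 2)]⟩
  set s := 2 * ε / δ with hs
  have hs1 : s ≤ 1 := (div_le_one hδ0).2 h2ε
  have hs0 : 0 < s := by positivity
  have hsδ : s * δ = 2 * ε := div_mul_cancel₀ _ hδ0.ne'
  -- the translation carries `x` to the point of `[x, q]` at distance `2 ε` from `q`
  set z := (1 - s) • (q - x) with hz
  have hznorm : ‖z‖ = δ - 2 * ε := by
    rw [hz, norm_smul, Real.norm_of_nonneg (by linarith), ← dist_eq_norm, dist_comm, ← hδ]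
    linarith
  have hzq : dist (x + z) q = 2 * ε := by
    have : x + z - q = s • (x - q) := by rw [hz]; module
    rw [dist_eq_norm, this, norm_smul, Real.norm_of_nonneg hs0.le, ← dist_eq_norm, ← hδ, hsδ]
  have htube : ∀ ξ ∈ Metric.ball x ε, ∀ t ∈ Icc (0 : ℝ) 1, dist (ξ + t • z) x < δ - ε := by
    intro ξ hξ t ht
    have h1 : ξ + t • z - x = (ξ - x) + t • z := by abel
    rw [dist_eq_norm, h1]
    have h2 : ‖t • z‖ ≤ δ - 2 * ε := by
      rw [norm_smul, Real.norm_of_nonneg ht.1, hznorm]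
      exact mul_le_of_le_one_left (by linarith) ht.2
    have h3 : ‖ξ - x‖ < ε := by rw [← dist_eq_norm]; exact hξ
    linarith [norm_add_le (ξ - x) (t • z)]
  have htubeU : ∀ y, dist y x < δ - ε → y ∈ U ∧ ε ≤ Metric.infDist y (frontier U) := by
    intro y hy
    refine ⟨ball_infDist_frontier_subset hU hx ?_, ?_⟩
    · rw [hxq, Metric.mem_ball]; linarith
    · have := Metric.infDist_le_infDist_add_dist (s := frontier U) (x := x) (y := y)
      rw [hxq, dist_comm x y] at this
      linarith
  set D := Metric.diam (closure U) with hD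
  have hDpos : 0 < D := by
    have := infDist_frontier_le_diam hb hne hx
    rw [hxq] at this
    linarith
  set Z : ℝ≥0∞ := ENNReal.ofReal (√ε)⁻¹ with hZ
  set K : ℝ≥0∞ := ‖z‖ₑ ^ 2 * Z with hK
  refine ⟨ε, hε, Z * (2 * (ENNReal.ofReal √D * C + K)), ?_, fun v hv h0 => ?_⟩
  · have hKt : K ≠ ⊤ := ENNReal.mul_ne_top (by simp) ENNReal.ofReal_ne_top
    exact ENNReal.mul_ne_top ENNReal.ofReal_ne_top (ENNReal.mul_ne_top (by simp)
      (ENNReal.add_ne_top.2 ⟨ENNReal.mul_ne_top ENNReal.ofReal_ne_top hC, hKt⟩))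
  set G := U.indicator (fun y =>
    ‖fderiv ℝ v y‖ₑ ^ 2 * ENNReal.ofReal √(Metric.infDist y (frontier U))) with hGdef
  have hG : Measurable G := (measurable_energyDensity (U := U) hv).indicator hU.measurableSet
  have hsε : 0 < √ε := Real.sqrt_pos.2 hε
  have hweight : ∀ y, dist y x < δ - ε → ‖fderiv ℝ v y‖ₑ ^ 2 ≤ Z * G y := by
    intro y hy
    obtain ⟨hyU, hyd⟩ := htubeU y hy
    rw [hGdef, indicator_of_mem hyU, mul_left_comm, hZ, ← ENNReal.ofReal_mul (by positivity)]
    refine le_mul_of_one_le_right zero_le (ENNReal.one_le_ofReal.2 ?_)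
    rw [inv_mul_eq_div, one_le_div hsε]
    exact Real.sqrt_le_sqrt hyd
  have hpt : ∀ ξ ∈ U ∩ Metric.ball x ε,
      ‖v ξ‖ₑ ^ 2 * ENNReal.ofReal (√(Metric.infDist ξ (frontier U)))⁻¹ ≤
      Z * (2 * (‖v (ξ + z)‖ₑ ^ 2 + K * ∫⁻ τ in Ioo (0 : ℝ) 1, G (ξ + τ • z))) := by
    rintro ξ ⟨_, hξ⟩
    have hcont : Continuous fun τ : ℝ => fderiv ℝ v (ξ + τ • z) :=
      (hv.continuous_fderiv one_ne_zero).comp (by fun_prop)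
    have h1 := enorm_le_add_lintegral_segment hv ξ z zero_le_one
    rw [one_smul] at h1
    have h2 := lintegral_sq_le_weighted (μ := volume.restrict (Ioo (0 : ℝ) 1))
      (f := fun τ => ‖fderiv ℝ v (ξ + τ • z)‖ₑ) (w := fun _ => 1)
      hcont.enorm.aemeasurable aemeasurable_const (by simp) (by simp)
    have h3 : ∫⁻ τ in Ioo (0 : ℝ) 1, ‖fderiv ℝ v (ξ + τ • z)‖ₑ ^ 2
        ≤ Z * ∫⁻ τ in Ioo (0 : ℝ) 1, G (ξ + τ • z) := by
      rw [← lintegral_const_mul' _ _ ENNReal.ofReal_ne_top]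
      exact setLIntegral_mono_ae' measurableSet_Ioo (Filter.Eventually.of_forall fun τ hτ =>
        hweight _ (htube ξ hξ τ ⟨hτ.1.le, hτ.2.le⟩))
    simp only [mul_one, inv_one, lintegral_const, Measure.restrict_apply_univ, Real.volume_Ioo,
      sub_zero, ENNReal.ofReal_one] at h2
    have hξd : ε ≤ Metric.infDist ξ (frontier U) :=
      (htubeU ξ (by simpa using htube ξ hξ 0 ⟨le_rfl, zero_le_one⟩)).2
    have h4 : ENNReal.ofReal (√(Metric.infDist ξ (frontier U)))⁻¹ ≤ Z :=
      ENNReal.ofReal_le_ofReal (inv_anti₀ hsε (Real.sqrt_le_sqrt hξd))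
    rw [mul_comm]
    have hadd : ∀ s t : ℝ≥0∞, (s + t) ^ 2 ≤ 2 * (s ^ 2 + t ^ 2) := fun s t => by
      have h := ENNReal.rpow_add_le_mul_rpow_add_rpow s t (p := 2) one_le_two
      norm_num at h
      exact h
    refine mul_le_mul' h4 ((pow_le_pow_left₀ zero_le h1 2).trans ((hadd _ _).trans ?_))
    gcongr
    rw [mul_pow, hK, mul_assoc]
    gcongr
    exact h2.trans h3
  have hmass : ∫⁻ ξ in U ∩ Metric.ball x ε, ‖v (ξ + z)‖ₑ ^ 2 ≤
      ENNReal.ofReal √D * weightedMass U (Metric.ball q ρ) v := by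
    have hm : Measurable fun y => (U ∩ Metric.ball q ρ).indicator (fun y => ‖v y‖ₑ ^ 2) y :=
      ((hv.continuous.enorm.measurable).pow_const 2).indicator
        (hU.measurableSet.inter measurableSet_ball)
    calc ∫⁻ ξ in U ∩ Metric.ball x ε, ‖v (ξ + z)‖ₑ ^ 2
        ≤ ∫⁻ ξ in U ∩ Metric.ball x ε,
          (U ∩ Metric.ball q ρ).indicator (fun y => ‖v y‖ₑ ^ 2) (ξ + z) := by
          refine setLIntegral_mono_ae' (hU.measurableSet.inter measurableSet_ball)
            (Filter.Eventually.of_forall fun ξ hξ => ?_)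
          have h1 : ξ + z ∈ U := by
            simpa using (htubeU _ (htube ξ hξ.2 1 ⟨zero_le_one, le_rfl⟩)).1
          have h2 : ξ + z ∈ Metric.ball q ρ := by
            have h3 := dist_triangle (ξ + z) (x + z) q
            rw [dist_add_right, hzq] at h3
            have := Metric.mem_ball.1 hξ.2
            rw [Metric.mem_ball]
            linarith
          exact (indicator_of_mem (s := U ∩ Metric.ball q ρ) ⟨h1, h2⟩ fun y => ‖v y‖ₑ ^ 2).ge
      _ ≤ ∫⁻ ξ, (U ∩ Metric.ball q ρ).indicator (fun y => ‖v y‖ₑ ^ 2) (ξ + z) :=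
          setLIntegral_le_lintegral _ _
      _ = ∫⁻ y in U ∩ Metric.ball q ρ, ‖v y‖ₑ ^ 2 := by
          rw [lintegral_add_right_eq_self
            (fun y => (U ∩ Metric.ball q ρ).indicator (fun y => ‖v y‖ₑ ^ 2) y) z,
            lintegral_indicator (hU.measurableSet.inter measurableSet_ball)]
      _ ≤ _ := by
          rw [weightedMass, ← lintegral_const_mul' _ _ ENNReal.ofReal_ne_top]
          refine setLIntegral_mono_ae' (hU.measurableSet.inter measurableSet_ball)
            (Filter.Eventually.of_forall fun y hy => ?_)
          rw [mul_left_comm, ← ENNReal.ofReal_mul (by positivity)]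
          refine le_mul_of_one_le_right zero_le (ENNReal.one_le_ofReal.2 ?_)
          rw [← div_eq_mul_inv,
            one_le_div (Real.sqrt_pos.2 (infDist_frontier_pos hU hne hy.1))]
          exact Real.sqrt_le_sqrt (infDist_frontier_le_diam hb hne hy.1)
  have hmv : Measurable fun ξ => ‖v (ξ + z)‖ₑ ^ 2 :=
    (Continuous.enorm (hv.continuous.comp (by fun_prop))).measurable.pow_const 2
  calc weightedMass U (Metric.ball x ε) v ≤ _ :=
        setLIntegral_mono_ae' (hU.measurableSet.inter measurableSet_ball)
          (Filter.Eventually.of_forall hpt)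
    _ = Z * (2 * ((∫⁻ ξ in U ∩ Metric.ball x ε, ‖v (ξ + z)‖ₑ ^ 2) +
        K * ∫⁻ ξ in U ∩ Metric.ball x ε, ∫⁻ τ in Ioo (0 : ℝ) 1, G (ξ + τ • z))) := by
        rw [lintegral_const_mul' _ _ ENNReal.ofReal_ne_top, lintegral_const_mul' _ _ (by simp),
          lintegral_add_left hmv, lintegral_const_mul' _ _
            (ENNReal.mul_ne_top (by simp) ENNReal.ofReal_ne_top)]
    _ ≤ Z * (2 * (ENNReal.ofReal √D * (C * weightedEnergy U v) + K * weightedEnergy U v)) := by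
        gcongr
        · exact hmass.trans (mul_le_mul_right (hCv v hv h0) _)
        · refine (lintegral_lintegral_segment_le hG _ _ _).trans_eq ?_
          rw [ENNReal.ofReal_one, one_mul, hGdef, lintegral_indicator hU.measurableSet,
            weightedEnergy]
    _ = _ := by ring

theorem nonempty_frontier_of_isBounded (hn : 1 ≤ n) (hb : Bornology.IsBounded U)
    (hne : U.Nonempty) : (frontier U).Nonempty := by
  have : Nonempty (Fin n) := ⟨⟨0, hn⟩⟩
  rw [nonempty_frontier_iff]
  refine ⟨hne, fun h => ?_⟩
  rw [h] at hb
  exact NormedSpace.unbounded_univ ℝ (EuclideanSpace ℝ (Fin n)) hb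

/-- The weighted Poincaré–Friedrichs inequality on a bounded Lipschitz domain. -/
theorem HasLipschitzBoundary.weightedPoincareOn (hL : HasLipschitzBoundary U) (hU : IsOpen U)
    (hb : Bornology.IsBounded U) (hne : (frontier U).Nonempty) :
    WeightedPoincareOn U (closure U) := by
  refine hb.isCompact_closure.induction_on WeightedPoincareOn.empty
    (fun s t hst ht => ht.mono hst) (fun s t hs ht => hs.union ht) fun x hx => ?_
  suffices ∃ r > 0, WeightedPoincareOn U (Metric.ball x r) by
    obtain ⟨r, hr, h⟩ := this
    exact ⟨_, mem_nhdsWithin_of_mem_nhds (Metric.ball_mem_nhds x hr), h⟩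
  have hq : ∀ q ∈ frontier U, ∃ r > 0, WeightedPoincareOn U (Metric.ball q r) :=
    fun q hq => hL.weightedPoincareOn_ball hU hq
  by_cases hxU : x ∈ U
  · exact WeightedPoincareOn.exists_ball_of_mem hU hq hb hne hxU
  · exact hq x (by rw [hU.frontier_eq]; exact ⟨hx, hxU⟩)

end LipschitzDomain

/-! ### Injective immersions of compact sets -/

/-- An injective `C¹` immersion is bi-Lipschitz from below on a compact set: near the diagonal this
is strict differentiability, away from it injectivity. -/
theorem IsCompact.exists_mul_dist_le_of_injOn_immersion {E F : Type*} [NormedAddCommGroup E]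
    [NormedSpace ℝ E] [FiniteDimensional ℝ E] [NormedAddCommGroup F] [NormedSpace ℝ F]
    {K V : Set E} {f : E → F} (hK : IsCompact K) (hV : IsOpen V) (hKV : K ⊆ V)
    (hf : ContDiffOn ℝ 1 f V) (hinj : InjOn f K)
    (himm : ∀ x ∈ K, Function.Injective (fderiv ℝ f x)) :
    ∃ m > 0, ∀ x ∈ K, ∀ y ∈ K, m * dist x y ≤ dist (f x) (f y) := by
  suffices ∃ m > 0, ∀ p ∈ K ×ˢ K, m * dist p.1 p.2 ≤ dist (f p.1) (f p.2) by
    obtain ⟨m, hm, h⟩ := this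
    exact ⟨m, hm, fun x hx y hy => h (x, y) ⟨hx, hy⟩⟩
  refine (hK.prod hK).induction_on
    (p := fun s => ∃ m > 0, ∀ p ∈ s, m * dist p.1 p.2 ≤ dist (f p.1) (f p.2))
    ⟨1, one_pos, by simp⟩ (fun s t hst ⟨m, hm, h⟩ => ⟨m, hm, fun p hp => h p (hst hp)⟩) ?_ ?_
  · rintro s t ⟨m, hm, h⟩ ⟨m', hm', h'⟩
    refine ⟨min m m', lt_min hm hm', ?_⟩
    rintro p (hp | hp)
    · exact (mul_le_mul_of_nonneg_right (min_le_left _ _) dist_nonneg).trans (h p hp)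
    · exact (mul_le_mul_of_nonneg_right (min_le_right _ _) dist_nonneg).trans (h' p hp)
  · rintro ⟨x, y⟩ ⟨hx : x ∈ K, hy : y ∈ K⟩
    have hcd : ∀ z ∈ K, ContDiffAt ℝ 1 f z := fun z hz => hf.contDiffAt (hV.mem_nhds (hKV hz))
    suffices ∃ m > 0, ∀ᶠ p : E × E in 𝓝 (x, y), m * dist p.1 p.2 ≤ dist (f p.1) (f p.2) by
      obtain ⟨m, hm, h⟩ := this
      exact ⟨_, mem_nhdsWithin_of_mem_nhds h, m, hm, fun p hp => hp⟩
    by_cases hxy : x = y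
    · subst hxy
      obtain ⟨c, hc, hanti⟩ := LinearMap.exists_antilipschitzWith
        (fderiv ℝ f x).toLinearMap (LinearMap.ker_eq_bot.2 (himm x hx))
      have hc' : (0 : ℝ) < c := hc
      have hstrict := (hcd x hx).hasStrictFDerivAt one_ne_zero
      refine ⟨(2 * c : ℝ)⁻¹, by positivity, ?_⟩
      filter_upwards [hstrict.isLittleO.bound (by positivity : (0 : ℝ) < (2 * c : ℝ)⁻¹)] with p hp
      have h1 : dist p.1 p.2 ≤ c * ‖fderiv ℝ f x (p.1 - p.2)‖ := by
        have := hanti.le_mul_dist p.1 p.2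
        rwa [dist_eq_norm (_ : F), ← map_sub] at this
      have h2 := norm_sub_norm_le (fderiv ℝ f x (p.1 - p.2)) (f p.1 - f p.2)
      rw [norm_sub_rev (fderiv ℝ f x (p.1 - p.2))] at h2
      rw [dist_eq_norm] at h1 ⊢
      rw [dist_eq_norm]
      have h3 : (c : ℝ)⁻¹ * ‖p.1 - p.2‖ ≤ ‖fderiv ℝ f x (p.1 - p.2)‖ :=
        (inv_mul_le_iff₀ hc').2 h1
      have h4 : (c : ℝ)⁻¹ = 2 * (2 * c : ℝ)⁻¹ := by field_simp
      rw [h4] at h3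
      linarith
    · have hpos : 0 < dist (f x) (f y) := dist_pos.2 fun h => hxy (hinj hx hy h)
      have hcont : ContinuousAt (fun p : E × E => dist (f p.1) (f p.2)) (x, y) :=
        ((hcd x hx).continuousAt.comp (x := (x, y)) continuousAt_fst).dist
          ((hcd y hy).continuousAt.comp (x := (x, y)) continuousAt_snd)
      have hdist : ContinuousAt (fun p : E × E => dist p.1 p.2) (x, y) :=
        continuous_dist.continuousAt
      refine ⟨dist (f x) (f y) / 2 / (dist x y + 1), by positivity, ?_⟩
      filter_upwards [hcont.eventually_const_lt (half_lt_self hpos),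
        hdist.eventually_lt_const (lt_add_one _)] with p hp1 hp2
      rw [div_mul_eq_mul_div, div_le_iff₀ (by positivity)]
      gcongr

/-- A lower Lipschitz bound near a point passes to the derivative. -/
theorem HasFDerivAt.mul_norm_le_of_mul_dist_le {E F : Type*} [NormedAddCommGroup E]
    [NormedSpace ℝ E] [NormedAddCommGroup F] [NormedSpace ℝ F] {f : E → F} {A : E →L[ℝ] F} {x : E}
    {m : ℝ} (hf : HasFDerivAt f A x) (hm : ∀ᶠ y in 𝓝 x, m * dist y x ≤ dist (f y) (f x)) (h : E) :
    m * ‖h‖ ≤ ‖A h‖ := by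
  have h1 : HasDerivAt (fun t : ℝ => f (x + t • h)) (A h) 0 := by
    have h2 : HasDerivAt (fun t : ℝ => x + t • h) h 0 := by
      simpa using ((hasDerivAt_id (0 : ℝ)).smul_const h).const_add x
    exact HasFDerivAt.comp_hasDerivAt (0 : ℝ) (by simpa using hf) h2
  have h3 := (hasDerivAt_iff_tendsto_slope_zero.1 h1).norm
  have h4 : Filter.Tendsto (fun t : ℝ => x + t • h) (𝓝[≠] 0) (𝓝 x) := by
    have : Continuous fun t : ℝ => x + t • h := by fun_prop
    simpa using (this.tendsto 0).mono_left nhdsWithin_le_nhds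
  refine ge_of_tendsto h3 ?_
  filter_upwards [h4.eventually hm, self_mem_nhdsWithin] with t ht ht0
  have ht' : 0 < |t| := abs_pos.2 ht0
  rw [dist_eq_norm, dist_eq_norm, add_sub_cancel_left, norm_smul, Real.norm_eq_abs] at ht
  simp only [zero_add, zero_smul, add_zero, norm_smul, norm_inv, Real.norm_eq_abs]
  rw [le_inv_mul_iff₀ ht']
  linarith

/-! ### Transfer to the hypersurface -/

namespace BoundedHypersurface

variable {n : ℕ} (S : BoundedHypersurface n)

theorem differentiableAt_param {x : EuclideanSpace ℝ (Fin n)} (hx : x ∈ closure S.chart) :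
    DifferentiableAt ℝ S.param x := by
  obtain ⟨V, hV, hsub, hc⟩ := S.contDiff_param
  exact (hc.differentiableOn one_ne_zero).differentiableAt (hV.mem_nhds (hsub hx))

theorem isCompact_closure_chart : IsCompact (closure S.chart) :=
  S.isBounded_chart.isCompact_closure

theorem continuousOn_param : ContinuousOn S.param (closure S.chart) :=
  fun _ hx => (S.differentiableAt_param hx).continuousAt.continuousWithinAt

theorem exists_mul_dist_le :
    ∃ m > 0, ∀ x ∈ closure S.chart, ∀ y ∈ closure S.chart,
      m * dist x y ≤ dist (S.param x) (S.param y) := by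
  obtain ⟨V, hV, hsub, hc⟩ := S.contDiff_param
  exact S.isCompact_closure_chart.exists_mul_dist_le_of_injOn_immersion hV hsub hc S.injOn_param
    S.immersion_param

theorem exists_norm_fderiv_param_le :
    ∃ M > 0, ∀ x ∈ closure S.chart, ‖fderiv ℝ S.param x‖ ≤ M := by
  obtain ⟨V, hV, hsub, hc⟩ := S.contDiff_param
  obtain ⟨M, hM⟩ := S.isCompact_closure_chart.exists_bound_of_continuousOn
    ((hc.continuousOn_fderiv_of_isOpen hV le_rfl).mono hsub)
  exact ⟨max M 1, by positivity, fun x hx => (hM x hx).trans (le_max_left _ _)⟩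

theorem norm_gradient_le_tangentialGradient (u : EuclideanSpace ℝ (Fin (n + 1)) → ℝ)
    {x : EuclideanSpace ℝ (Fin n)} (hx : x ∈ S.chart) :
    ‖gradient (u ∘ S.param) x‖ ≤
      ‖fderiv ℝ S.param x‖ * ‖S.tangentialGradient u (S.param x)‖ := by
  rw [tangentialGradient, S.alpha_param hx]
  have h := S.firstFundamentalForm_inverse hx (gradient (u ∘ S.param) x)
  have hA : ‖ContinuousLinearMap.adjoint (fderiv ℝ S.param x)‖ = ‖fderiv ℝ S.param x‖ :=
    LinearIsometryEquiv.norm_map _ _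
  conv_lhs => rw [← h]
  rw [← hA, firstFundamentalForm, ContinuousLinearMap.comp_apply]
  exact (ContinuousLinearMap.adjoint (fderiv ℝ S.param x)).le_opNorm _

theorem mul_norm_tangentialGradient_le (u : EuclideanSpace ℝ (Fin (n + 1)) → ℝ)
    {x : EuclideanSpace ℝ (Fin n)} (hx : x ∈ S.chart) {m : ℝ} (hm : 0 ≤ m)
    (hmx : ∀ h, m * ‖h‖ ≤ ‖fderiv ℝ S.param x h‖) :
    m * ‖S.tangentialGradient u (S.param x)‖ ≤ ‖gradient (u ∘ S.param) x‖ := by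
  rw [tangentialGradient, S.alpha_param hx]
  have h := S.firstFundamentalForm_inverse hx (gradient (u ∘ S.param) x)
  set w := (S.firstFundamentalForm x).inverse (gradient (u ∘ S.param) x)
  set T := fderiv ℝ S.param x w with hT
  have h1 : ‖T‖ * ‖T‖ = ⟪gradient (u ∘ S.param) x, w⟫_ℝ := by
    rw [← h, firstFundamentalForm, ContinuousLinearMap.comp_apply,
      ContinuousLinearMap.adjoint_inner_left, real_inner_self_eq_norm_mul_norm]
  have h2 := real_inner_le_norm (gradient (u ∘ S.param) x) w
  rw [← h1] at h2
  have h3 := hmx w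
  rcases (norm_nonneg T).eq_or_lt with h0 | h0
  · rw [← h0, mul_zero]; exact norm_nonneg _
  · refine le_of_mul_le_mul_right ?_ h0
    calc m * ‖T‖ * ‖T‖ = m * (‖T‖ * ‖T‖) := mul_assoc _ _ _
      _ ≤ m * (‖gradient (u ∘ S.param) x‖ * ‖w‖) := by gcongr
      _ = ‖gradient (u ∘ S.param) x‖ * (m * ‖w‖) := by ring
      _ ≤ _ := by gcongr

/-- The zero extension to `ℝⁿ` of a function on the hypersurface, read in the chart. -/
noncomputable def zeroExtension (u : EuclideanSpace ℝ (Fin (n + 1)) → ℝ) :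
    EuclideanSpace ℝ (Fin n) → ℝ :=
  S.chart.indicator (u ∘ S.param)

theorem zeroExtension_eventuallyEq (u : EuclideanSpace ℝ (Fin (n + 1)) → ℝ)
    {x : EuclideanSpace ℝ (Fin n)} (hx : x ∈ S.chart) :
    S.zeroExtension u =ᶠ[𝓝 x] u ∘ S.param :=
  Filter.eventuallyEq_of_mem (S.isOpen_chart.mem_nhds hx) fun _ hy => indicator_of_mem hy _

theorem norm_fderiv_zeroExtension (u : EuclideanSpace ℝ (Fin (n + 1)) → ℝ)
    {x : EuclideanSpace ℝ (Fin n)} (hx : x ∈ S.chart) :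
    ‖fderiv ℝ (S.zeroExtension u) x‖ = ‖gradient (u ∘ S.param) x‖ := by
  rw [gradient, LinearIsometryEquiv.norm_map, (S.zeroExtension_eventuallyEq u hx).fderiv_eq]

variable {S}

theorem IsTestFunction.exists_isCompact {u : EuclideanSpace ℝ (Fin (n + 1)) → ℝ}
    (hu : S.IsTestFunction u) :
    ∃ K ⊆ S.chart, IsCompact K ∧ ∀ x ∉ K, S.zeroExtension u x = 0 := by
  obtain ⟨-, K, hKs, hK, hu0⟩ := hu
  refine ⟨closure S.chart ∩ S.param ⁻¹' K, ?_, ?_, ?_⟩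
  · rintro x ⟨hx, hxK⟩
    obtain ⟨y, hy, hyx⟩ := hKs hxK
    rwa [← S.injOn_param (subset_closure hy) hx hyx]
  · exact S.isCompact_closure_chart.of_isClosed_subset
      (S.continuousOn_param.preimage_isClosed_of_isClosed isClosed_closure hK.isClosed)
      inter_subset_left
  · intro x hx
    by_cases hxc : x ∈ S.chart
    · rw [zeroExtension, indicator_of_mem hxc]
      exact hu0 _ ⟨x, hxc, rfl⟩ fun h => hx ⟨subset_closure hxc, h⟩
    · exact indicator_of_notMem hxc _

theorem IsTestFunction.contDiff_zeroExtension {u : EuclideanSpace ℝ (Fin (n + 1)) → ℝ}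
    (hu : S.IsTestFunction u) : ContDiff ℝ 1 (S.zeroExtension u) := by
  obtain ⟨K, hKs, hK, h0⟩ := hu.exists_isCompact
  rw [contDiff_iff_contDiffAt]
  intro x
  by_cases hx : x ∈ S.chart
  · refine ContDiffAt.congr_of_eventuallyEq ?_ (S.zeroExtension_eventuallyEq u hx)
    exact (hu.1.contDiffAt (S.isOpen_chart.mem_nhds hx)).of_le (by exact_mod_cast le_top)
  · refine (contDiffAt_const (c := (0 : ℝ))).congr_of_eventuallyEq ?_
    exact Filter.eventuallyEq_of_mem
      (hK.isClosed.isOpen_compl.mem_nhds fun h => hx (hKs h)) fun y hy => h0 y hy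

theorem IsTestFunction.exists_norm_fderiv_le {u : EuclideanSpace ℝ (Fin (n + 1)) → ℝ}
    (hu : S.IsTestFunction u) : ∃ B, ∀ x, ‖fderiv ℝ (S.zeroExtension u) x‖ ≤ B := by
  obtain ⟨K, -, hK, h0⟩ := hu.exists_isCompact
  exact (hu.contDiff_zeroExtension.continuous_fderiv one_ne_zero).bounded_above_of_compact_support
    ((HasCompactSupport.intro hK fun x hx => h0 x hx).fderiv ℝ)

variable (S)

theorem exists_mul_infDist_le :
    ∃ m > 0, ∀ x ∈ S.chart, m * Metric.infDist x (frontier S.chart) ≤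
      Metric.infDist (S.param x) S.boundary := by
  obtain ⟨m, hm, h⟩ := S.exists_mul_dist_le
  refine ⟨m, hm, fun x hx => ?_⟩
  rcases (frontier S.chart).eq_empty_or_nonempty with he | hne
  · simp [he, boundary]
  · refine (Metric.le_infDist (hne.image _)).2 ?_
    rintro _ ⟨y, hy, rfl⟩
    exact (mul_le_mul_of_nonneg_left (Metric.infDist_le_dist_of_mem hy) hm.le).trans
      (h x (subset_closure hx) y hy.1)

theorem exists_infDist_boundary_le :
    ∃ R, 0 ≤ R ∧ ∀ x ∈ S.chart, Metric.infDist (S.param x) S.boundary ≤ R := by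
  refine ⟨Metric.diam (S.param '' closure S.chart), Metric.diam_nonneg, fun x hx => ?_⟩
  rcases (frontier S.chart).eq_empty_or_nonempty with he | ⟨q, hq⟩
  · simp [he, boundary, Metric.diam_nonneg]
  · exact (Metric.infDist_le_dist_of_mem (mem_image_of_mem _ hq)).trans
      (Metric.dist_le_diam_of_mem
        (S.isCompact_closure_chart.image_of_continuousOn S.continuousOn_param).isBounded
        (mem_image_of_mem _ (subset_closure hx)) (mem_image_of_mem _ hq.1))

variable {S}

/-- The aperture function is bounded below by a multiple of the square root of the distance to the
boundary, measured in the chart. -/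
theorem ApertureAssumptions.exists_mul_sqrt_infDist_le
    {b χ f : EuclideanSpace ℝ (Fin (n + 1)) → ℝ} (hb : S.ApertureAssumptions b χ f) :
    ∃ κ > 0, ∀ᵐ x ∂(volume.restrict S.chart),
      κ * √(Metric.infDist x (frontier S.chart)) ≤ b (S.param x) := by
  obtain ⟨c, hc, hform⟩ := hb.formula
  obtain ⟨a, ha, hfa⟩ := hb.profile_lower
  obtain ⟨m, hm, hdist⟩ := S.exists_mul_infDist_le
  obtain ⟨R, hR, hRle⟩ := S.exists_infDist_boundary_le
  -- with this `θ` both `dist^{1/2}` and the profile dominate `θ dist^{1/2}`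
  set θ := min 1 (a / (√R + 1)) with hθ
  have hθ0 : 0 < θ := by positivity
  refine ⟨c * θ * √m, by have := Real.sqrt_pos.2 hm; positivity, ?_⟩
  filter_upwards [hform, hfa, ae_restrict_mem S.isOpen_chart.measurableSet] with x hx hxa hxU
  obtain ⟨h0, h1⟩ := hb.cutoff_mem (S.param x)
  set D := Metric.infDist (S.param x) S.boundary
  have hD : √m * √(Metric.infDist x (frontier S.chart)) ≤ √D := by
    rw [← Real.sqrt_mul hm.le]; exact Real.sqrt_le_sqrt (hdist x hxU)
  have hDR : √D ≤ √R := Real.sqrt_le_sqrt (hRle x hxU)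
  have h2 : θ * √D ≤ √D := mul_le_of_le_one_left (Real.sqrt_nonneg _) (min_le_left _ _)
  have h3 : θ * √D ≤ f (S.param x) := by
    refine le_trans ?_ hxa
    calc θ * √D ≤ a / (√R + 1) * (√R + 1) := by
          gcongr
          · exact min_le_right _ _
          · linarith
      _ = a := div_mul_cancel₀ _ (by positivity)
  rw [hx]
  calc c * θ * √m * √(Metric.infDist x (frontier S.chart))
      = c * (θ * (√m * √(Metric.infDist x (frontier S.chart)))) := by ring
    _ ≤ c * (θ * √D) := by gcongr
    _ = c * (χ (S.param x) * (θ * √D) + (1 - χ (S.param x)) * (θ * √D)) := by ring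
    _ ≤ _ := by
      have : 0 ≤ 1 - χ (S.param x) := sub_nonneg.2 h1
      gcongr

/-- Finiteness of the right-hand side: the tangential gradient of a test function is bounded, and
so is the aperture function. -/
theorem ApertureAssumptions.weightedNorm_tangentialGradient_lt_top
    {b χ f u : EuclideanSpace ℝ (Fin (n + 1)) → ℝ} (hb : S.ApertureAssumptions b χ f)
    (hu : S.IsTestFunction u) : S.weightedNorm b (S.tangentialGradient u) < ⊤ := by
  obtain ⟨m, hm, hdist⟩ := S.exists_mul_dist_le
  obtain ⟨B, hB⟩ := hu.exists_norm_fderiv_le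
  obtain ⟨β, -, hβ⟩ := hb.bounded
  refine ENNReal.rpow_lt_top_of_nonneg (by norm_num) (ne_of_lt ?_)
  calc _ ≤ ∫⁻ _ in S.chart, ENNReal.ofReal (B / m) ^ 2 * ENNReal.ofReal β := by
        refine lintegral_mono_ae ?_
        filter_upwards [hβ, ae_restrict_mem S.isOpen_chart.measurableSet] with x hx hxU
        have h1 : ‖S.tangentialGradient u (S.param x)‖ ≤ B / m := by
          rw [le_div_iff₀ hm, mul_comm]
          refine (S.mul_norm_tangentialGradient_le u hxU hm.le ?_).trans
            ((S.norm_fderiv_zeroExtension u hxU).symm.trans_le (hB x))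
          refine (S.differentiableAt_param (subset_closure hxU)).hasFDerivAt
            |>.mul_norm_le_of_mul_dist_le ?_
          filter_upwards [S.isOpen_chart.mem_nhds hxU] with y hy
          exact hdist y (subset_closure hy) x (subset_closure hxU)
        rw [← ofReal_norm]
        gcongr
        exact (le_abs_self _).trans hx
    _ < ⊤ := by
        rw [lintegral_const, Measure.restrict_apply_univ]
        exact ENNReal.mul_lt_top (ENNReal.mul_lt_top (by simp) ENNReal.ofReal_lt_top)
          S.isBounded_chart.measure_lt_top

end BoundedHypersurface

theorem mainTheorem2 (n : ℕ) (hn : 1 ≤ n) (S : BoundedHypersurface n)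
    (b χ f : EuclideanSpace ℝ (Fin (n + 1)) → ℝ) (hb : S.ApertureAssumptions b χ f) :
    ∃ C : ℝ, 0 < C ∧ ∀ u : EuclideanSpace ℝ (Fin (n + 1)) → ℝ, S.IsTestFunction u →
      S.weightedNorm b (S.tangentialGradient u) < ⊤ ∧
      S.weightedNorm (fun s => (b s)⁻¹) u ≤
        ENNReal.ofReal C * S.weightedNorm b (S.tangentialGradient u) := by
  rcases S.chart.eq_empty_or_nonempty with he | hne
  · exact ⟨1, one_pos, fun u hu => ⟨hb.weightedNorm_tangentialGradient_lt_top hu, by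
      simp [BoundedHypersurface.weightedNorm, he]⟩⟩
  have hfne := nonempty_frontier_of_isBounded hn S.isBounded_chart hne
  obtain ⟨K, hK, hpoin⟩ :=
    S.lipschitz_chart.weightedPoincareOn S.isOpen_chart S.isBounded_chart hfne
  obtain ⟨κ, hκ, hbκ⟩ := hb.exists_mul_sqrt_infDist_le
  obtain ⟨M, hM, hMle⟩ := S.exists_norm_fderiv_param_le
  set Q : ℝ≥0∞ := ENNReal.ofReal κ⁻¹ * (K * (ENNReal.ofReal M ^ 2 * ENNReal.ofReal κ⁻¹)) with hQ
  have hQt : Q ≠ ⊤ := by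
    have h1 : ENNReal.ofReal M ^ 2 ≠ ⊤ := by simp
    exact ENNReal.mul_ne_top ENNReal.ofReal_ne_top
      (ENNReal.mul_ne_top hK (ENNReal.mul_ne_top h1 ENNReal.ofReal_ne_top))
  refine ⟨(Q ^ (1 / 2 : ℝ)).toReal + 1, by positivity, fun u hu =>
    ⟨hb.weightedNorm_tangentialGradient_lt_top hu, ?_⟩⟩
  have hmass : ∫⁻ x in S.chart, ‖u (S.param x)‖ₑ ^ 2 * ENNReal.ofReal (b (S.param x))⁻¹ ≤
      ENNReal.ofReal κ⁻¹ * weightedMass S.chart (closure S.chart) (S.zeroExtension u) := by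
    rw [weightedMass, inter_eq_left.2 subset_closure,
      ← lintegral_const_mul' _ _ ENNReal.ofReal_ne_top]
    refine lintegral_mono_ae ?_
    filter_upwards [hbκ, ae_restrict_mem S.isOpen_chart.measurableSet] with x hx hxU
    -- positivity is what allows inverting `κ d^{1/2} ≤ b` with the convention `0⁻¹ = 0`
    have hd := Real.sqrt_pos.2 (infDist_frontier_pos S.isOpen_chart hfne hxU)
    rw [BoundedHypersurface.zeroExtension, indicator_of_mem hxU, mul_left_comm,
      ← ENNReal.ofReal_mul (by positivity), ← mul_inv]
    gcongr
    rfl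
  have henergy : weightedEnergy S.chart (S.zeroExtension u) ≤
      ENNReal.ofReal M ^ 2 * ENNReal.ofReal κ⁻¹ *
      ∫⁻ x in S.chart, ‖S.tangentialGradient u (S.param x)‖ₑ ^ 2 *
        ENNReal.ofReal (b (S.param x)) := by
    have h1 : ENNReal.ofReal M ^ 2 ≠ ⊤ := by simp
    rw [weightedEnergy, ← lintegral_const_mul' _ _ (ENNReal.mul_ne_top h1 ENNReal.ofReal_ne_top)]
    refine lintegral_mono_ae ?_
    filter_upwards [hbκ, ae_restrict_mem S.isOpen_chart.measurableSet] with x hx hxU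
    have h2 : ‖fderiv ℝ (S.zeroExtension u) x‖ₑ ≤
        ENNReal.ofReal M * ‖S.tangentialGradient u (S.param x)‖ₑ := by
      rw [← ofReal_norm, ← ofReal_norm, ← ENNReal.ofReal_mul hM.le,
        S.norm_fderiv_zeroExtension u hxU]
      refine ENNReal.ofReal_le_ofReal ((S.norm_gradient_le_tangentialGradient u hxU).trans ?_)
      gcongr
      exact hMle x (subset_closure hxU)
    rw [mul_mul_mul_comm, ← mul_pow, ← ENNReal.ofReal_mul (by positivity)]
    gcongr
    rwa [le_inv_mul_iff₀ hκ]
  have hsq : ∫⁻ x in S.chart, ‖u (S.param x)‖ₑ ^ 2 * ENNReal.ofReal (b (S.param x))⁻¹ ≤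
      Q * ∫⁻ x in S.chart, ‖S.tangentialGradient u (S.param x)‖ₑ ^ 2 *
        ENNReal.ofReal (b (S.param x)) := by
    refine hmass.trans ?_
    rw [hQ, mul_assoc, mul_assoc K]
    gcongr
    exact (hpoin _ hu.contDiff_zeroExtension fun x hx => indicator_of_notMem hx _).trans
      (by gcongr)
  calc S.weightedNorm (fun s => (b s)⁻¹) u
      ≤ (Q * ∫⁻ x in S.chart, ‖S.tangentialGradient u (S.param x)‖ₑ ^ 2 *
        ENNReal.ofReal (b (S.param x))) ^ (1 / 2 : ℝ) :=
        ENNReal.rpow_le_rpow hsq (by norm_num)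
    _ = Q ^ (1 / 2 : ℝ) * S.weightedNorm b (S.tangentialGradient u) :=
        ENNReal.mul_rpow_of_nonneg _ _ (by norm_num)
    _ ≤ _ := by
        gcongr
        rw [← ENNReal.ofReal_toReal
          (ENNReal.rpow_ne_top_of_nonneg (by norm_num : (0 : ℝ) ≤ 1 / 2) hQt)]
        refine ENNReal.ofReal_le_ofReal ?_
        rw [ENNReal.toReal_ofReal ENNReal.toReal_nonneg]
        linarith
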